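/- Let $\mathcal X,\mathcal Y$ be Polish spaces, $N\ge 1$, $\mu$ and $\nu$ Borel probability measures on $\mathcal X$ and $\mathcal Y$, and $c_1,\dots,c_N:\mathcal X\times\mathcal Y\to\mathbb R$ lower semicontinuous functions such that either all $c_i$ are non-negative, or all $c_i$ are (strictly) negative and bounded below. For positive finite measures $\alpha$ on $\mathcal X$ and $\beta$ on $\mathcal Y$ of the same mass let $\Pi_{\alpha,\beta}$ be the set of positive measures on $\mathcal X\times\mathcal Y$ with marginals $\alpha$ and $\beta$, and let $W_{c}(\alpha,\beta)=\inf_{\gamma\in\Pi_{\alpha,\beta}}\int c\,d\gamma$. Let $\Gamma^N_{\mu,\nu}$ be the set of $N$-tuples $(\gamma_i)_{i=1}^N$ of positive measures on $\mathcal X\times\mathcal Y$ such that $\sum_i\gamma_i$ has marginals $\mu$ and $\nu$, let $\Upsilon^N_{\mu,\nu}$ be the set of $N$-tuples $(\mu_i,\nu_i)_{i=1}^N$ of pairs of positive measures on $\mathcal X$ and $\mathcal Y$ with $\sum_i\mu_i=\mu$, $\sum_i\nu_i=\nu$ and $\mu_i(\mathcal X)=\nu_i(\mathcal Y)$ for all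 $i$, and let $$\mathrm{EOT}_{\mathbf c}(\mu,\nu)=\inf_{(\gamma_i)_i\in\Gamma^N_{\mu,\nu}}\ \max_{1\le i\le N}\int c_i\,d\gamma_i\in(-\infty,+\infty].$$ (1) Suppose that $\mathrm{EOT}_{\mathbf c}(\mu,\nu)<\infty$. If $(\gamma_i^*)_{i=1}^N\in\Gamma^N_{\mu,\nu}$ attains this infimum, then for every $i$ $$\gamma_i^*\in\operatorname*{argmin}_{\gamma\in\Pi_{\mu_i^*,\nu_i^*}}\int c_i\,d\gamma ,$$ where $\mu_i^*$ and $\nu_i^*$ are the first and second marginals of $\gamma_i^*$. (2) Moreover (whether or not the value is finite), $$\mathrm{EOT}_{\mathbf c}(\mu,\nu)=\min\bigl\{t\in[-\infty,+\infty]\ :\ \exists\,(\mu_i,\nu_i)_{i=1}^N\in\Upsilon^N_{\mu,\nu}\ \ \forall i\ \ W_{c_i}(\mu_i,\nu_i)=t\bigr\},$$ the minimum being attained. -/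

import Mathlib

open MeasureTheory

namespace EOT

noncomputable section

/-- The integral `∫ c dγ` with values in `[-∞, ∞]`, as the integral of the positive part of `c`
minus the integral of its negative part. For `c` bounded below and `γ` finite the subtracted term
is finite, so the difference is never of the form `∞ - ∞`. -/
def cost {Z : Type*} [MeasurableSpace Z] (c : Z → ℝ) (γ : Measure Z) : EReal :=
  ((∫⁻ z, ENNReal.ofReal (c z) ∂γ : ENNReal) : EReal)
    - ((∫⁻ z, ENNReal.ofReal (-c z) ∂γ : ENNReal) : EReal)

/-- `Π_{μ,ν}`: the couplings of the positive measures `μ` and `ν`. -/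
def couplings {X Y : Type*} [MeasurableSpace X] [MeasurableSpace Y]
    (μ : Measure X) (ν : Measure Y) : Set (Measure (X × Y)) :=
  {γ | γ.map Prod.fst = μ ∧ γ.map Prod.snd = ν}

/-- `Γ^N_{μ,ν}`: the `N`-tuples of positive measures on `X × Y` whose sum is a coupling
of `μ` and `ν`. -/
def couplingDecomps {X Y : Type*} [MeasurableSpace X] [MeasurableSpace Y] (N : ℕ)
    (μ : Measure X) (ν : Measure Y) : Set (Fin N → Measure (X × Y)) :=
  {γ | (∑ i, γ i).map Prod.fst = μ ∧ (∑ i, γ i).map Prod.snd = ν}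

/-- `Υ^N_{μ,ν}`: the decompositions of `μ` and `ν` into `N` positive measures, the `i`-th pieces
having the same total mass. -/
def marginalDecomps {X Y : Type*} [MeasurableSpace X] [MeasurableSpace Y] (N : ℕ)
    (μ : Measure X) (ν : Measure Y) : Set (Fin N → Measure X × Measure Y) :=
  {p | (∑ i, (p i).1) = μ ∧ (∑ i, (p i).2) = ν ∧
    ∀ i, (p i).1 Set.univ = (p i).2 Set.univ}

/-- `max_i ∫ c_i dγ_i` (a supremum over the finite index set). -/
def maxCost {X Y : Type*} [MeasurableSpace X] [MeasurableSpace Y] {N : ℕ}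
    (c : Fin N → X × Y → ℝ) (γ : Fin N → Measure (X × Y)) : EReal :=
  ⨆ i, cost (c i) (γ i)

/-- The value `EOT_c(μ,ν)` of the equitable and optimal transport problem. -/
def value {X Y : Type*} [MeasurableSpace X] [MeasurableSpace Y] {N : ℕ}
    (c : Fin N → X × Y → ℝ) (μ : Measure X) (ν : Measure Y) : EReal :=
  ⨅ γ ∈ couplingDecomps N μ ν, maxCost c γ

/-- `γ` is a solution of the equitable and optimal transport problem. -/
def IsSolution {X Y : Type*} [MeasurableSpace X] [MeasurableSpace Y] {N : ℕ}
    (c : Fin N → X × Y → ℝ) (μ : Measure X) (ν : Measure Y)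
    (γ : Fin N → Measure (X × Y)) : Prop :=
  γ ∈ couplingDecomps N μ ν ∧ maxCost c γ = value c μ ν

/-- The optimal transport cost `W_c(μ,ν)` between two positive measures of the same mass. -/
def W {X Y : Type*} [MeasurableSpace X] [MeasurableSpace Y]
    (c : X × Y → ℝ) (μ : Measure X) (ν : Measure Y) : EReal :=
  ⨅ γ ∈ couplings μ ν, cost c γ

/-- `γ` is an optimal transport plan for the cost `c` between `μ` and `ν`. -/
def IsOptimalPlan {X Y : Type*} [MeasurableSpace X] [MeasurableSpace Y]
    (c : X × Y → ℝ) (μ : Measure X) (ν : Measure Y) (γ : Measure (X × Y)) : Prop :=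
  γ ∈ couplings μ ν ∧ ∀ γ' ∈ couplings μ ν, cost c γ ≤ cost c γ'

/-- Either all costs are non-negative and lower semicontinuous, or all costs are negative,
bounded below and lower semicontinuous. -/
def ConstantSign {Z : Type*} [TopologicalSpace Z] {N : ℕ} (c : Fin N → Z → ℝ) : Prop :=
  (∀ i, LowerSemicontinuous (c i) ∧ ∀ z, 0 ≤ c i z) ∨
  (∀ i, LowerSemicontinuous (c i) ∧ BddBelow (Set.range (c i)) ∧ ∀ z, c i z < 0)

end

end EOT

namespace EOT

open Filter Topology ENNReal

/-! A solution exists by compactness (`exists_isSolution`): a tuple is one probability measure on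
`N` disjoint copies of `X × Y`, the marginal constraints cut out a tight closed set, and the maximal
cost is lower semicontinuous.

The key point is an exchange argument: if a piece is strictly below a finite maximum, mass can be
moved so that the maximum drops. Non-negative costs call for moving mass onto the cheap piece
(`exists_forall_lintegral_lt`), negative costs for giving some of it away
(`exists_forall_lt_lintegral`). So the costs of a solution of finite value all agree. Each piece is
then an optimal plan: a cheaper one with the same marginals would give an optimal tuple with unequal
costs. Hence the marginals of a solution realise the value as a common `W`; no smaller common value
is possible, by gluing near-optimal plans. If the value is infinite, proportional marginals do the
job. -/

theorem cost_eq_lintegral_sub {Ω : Type*} [MeasurableSpace Ω] {f : Ω → ℝ}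
    (hf : Measurable f) {C : ℝ} (hC : 0 ≤ C)
    (hfC : ∀ x, -C ≤ f x) (P : Measure Ω) [IsProbabilityMeasure P] :
    cost f P = ((∫⁻ x, ENNReal.ofReal (f x + C) ∂P : ℝ≥0∞) : EReal) - (C : EReal) := by
  -- Additive form of `f = (f + C) - C`, which avoids `∞ - ∞`.
  have key : ∫⁻ x, ENNReal.ofReal (f x + C) ∂P + ∫⁻ x, ENNReal.ofReal (-f x) ∂P
      = ∫⁻ x, ENNReal.ofReal (f x) ∂P + ENNReal.ofReal C := by
    have hconst : ENNReal.ofReal C = ∫⁻ _, ENNReal.ofReal C ∂P := by simp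
    rw [hconst, ← lintegral_add_left (by fun_prop), ← lintegral_add_left (by fun_prop)]
    refine lintegral_congr fun x ↦ ?_
    have := hfC x
    rcases le_total 0 (f x) with h | h
    · rw [ENNReal.ofReal_of_nonpos (neg_nonpos.2 h), add_zero, ENNReal.ofReal_add h hC]
    · rw [ENNReal.ofReal_of_nonpos h, zero_add,
        ← ENNReal.ofReal_add (by linarith) (by linarith)]
      congr 1
      ring
  have hfin : ∫⁻ x, ENNReal.ofReal (-f x) ∂P ≠ ⊤ := by
    refine ne_top_of_le_ne_top (ENNReal.ofReal_ne_top (r := C)) ?_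
    calc ∫⁻ x, ENNReal.ofReal (-f x) ∂P ≤ ∫⁻ _, ENNReal.ofReal C ∂P :=
          lintegral_mono fun x ↦ ENNReal.ofReal_le_ofReal (by linarith [hfC x])
      _ = ENNReal.ofReal C := by simp
  unfold cost
  generalize (∫⁻ x, ENNReal.ofReal (f x + C) ∂P) = A at *
  generalize (∫⁻ x, ENNReal.ofReal (f x) ∂P) = B at *
  lift (∫⁻ x, ENNReal.ofReal (-f x) ∂P) to NNReal using hfin with D
  have key' : (A : EReal) + ((D : ℝ) : EReal) = (B : EReal) + (C : EReal) := by
    have := congrArg ((↑) : ℝ≥0∞ → EReal) key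
    rwa [EReal.coe_ennreal_add, EReal.coe_ennreal_add, EReal.coe_ennreal_ofReal,
      max_eq_left hC] at this
  change (B : EReal) - ((D : ℝ) : EReal) = _
  induction A with
  | top =>
    induction B with
    | top => simp
    | coe b =>
      exfalso
      change (⊤ : EReal) + _ = ((b : ℝ) : EReal) + _ at key'
      rw [EReal.top_add_coe, ← EReal.coe_add] at key'
      exact EReal.coe_ne_top _ key'.symm
  | coe a =>
    induction B with
    | top =>
      exfalso
      change ((a : ℝ) : EReal) + _ = (⊤ : EReal) + _ at key'
      rw [EReal.top_add_coe, ← EReal.coe_add] at key'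
      exact EReal.coe_ne_top _ key'
    | coe b =>
      change ((a : ℝ) : EReal) + _ = ((b : ℝ) : EReal) + _ at key'
      change ((b : ℝ) : EReal) - _ = ((a : ℝ) : EReal) - _
      norm_cast at key' ⊢
      rw [NNReal.coe_add] at key'
      linarith

/-! ### Lower semicontinuity of the cost under weak convergence -/

section LowerSemicontinuity

variable {Ω : Type*} [TopologicalSpace Ω] [PolishSpace Ω] [MeasurableSpace Ω] [BorelSpace Ω]

/-- The integral of a nonnegative lower semicontinuous function is lower semicontinuous for the
weak convergence of probability measures. -/
theorem lowerSemicontinuous_lintegral_ofReal {f : Ω → ℝ} (hf : LowerSemicontinuous f)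
    (h0 : 0 ≤ f) :
    LowerSemicontinuous
      fun P : ProbabilityMeasure Ω ↦ ∫⁻ x, ENNReal.ofReal (f x) ∂(P : Measure Ω) := by
  let := TopologicalSpace.upgradeIsCompletelyMetrizable Ω
  rw [lowerSemicontinuous_iff_isClosed_preimage]
  intro y
  refine IsSeqClosed.isClosed fun Ps P hPs hlim ↦ ?_
  -- Layer-cake formula: the sets `{t < f}` are open, so the portmanteau inequality holds for each
  -- `t`, and Fatou's lemma in `t` concludes.
  have fatou : ∫⁻ x, ENNReal.ofReal (f x) ∂(P : Measure Ω)
      ≤ atTop.liminf fun n ↦ ∫⁻ x, ENNReal.ofReal (f x) ∂(Ps n : Measure Ω) := by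
    simp_rw [lintegral_eq_lintegral_meas_lt _ (Eventually.of_forall h0) hf.measurable.aemeasurable]
    refine (lintegral_mono fun t ↦ ProbabilityMeasure.le_liminf_measure_open_of_tendsto hlim
      (hf.isOpen_preimage t)).trans ?_
    exact lintegral_liminf_le fun n ↦ Antitone.measurable fun s t hst ↦
      measure_mono fun ω hω ↦ lt_of_le_of_lt hst hω
  exact fatou.trans (liminf_le_of_le (by isBoundedDefault) fun b hb ↦ by
    obtain ⟨n, hn⟩ := hb.exists
    exact hn.trans (hPs n))

theorem lowerSemicontinuous_cost {f : Ω → ℝ} (hf : LowerSemicontinuous f)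
    (hb : BddBelow (Set.range f)) :
    LowerSemicontinuous fun P : ProbabilityMeasure Ω ↦ cost f (P : Measure Ω) := by
  obtain ⟨m, hm⟩ := hb
  have hfC : ∀ x, -|m| ≤ f x := fun x ↦ (neg_abs_le m).trans (hm ⟨x, rfl⟩)
  have hlsc : LowerSemicontinuous fun x ↦ f x + |m| := hf.add lowerSemicontinuous_const
  have hcont : Continuous fun x : ℝ≥0∞ ↦ (x : EReal) - ((|m| : ℝ) : EReal) := by
    simp_rw [sub_eq_add_neg]
    rw [continuous_iff_continuousAt]
    intro x
    have h1 : ContinuousAt (fun x : ℝ≥0∞ ↦ ((x : EReal), -((|m| : ℝ) : EReal))) x :=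
      (continuous_coe_ennreal_ereal.prodMk continuous_const).continuousAt
    exact ContinuousAt.comp (f := fun x : ℝ≥0∞ ↦ ((x : EReal), -((|m| : ℝ) : EReal))) (g := fun p : EReal × EReal ↦ p.1 + p.2)
      (EReal.continuousAt_add (p := ((x : EReal), -((|m| : ℝ) : EReal)))
      (Or.inr (by simp)) (Or.inr (by simp))) h1
  have hmono : Monotone fun x : ℝ≥0∞ ↦ (x : EReal) - ((|m| : ℝ) : EReal) :=
    fun a b hab ↦ EReal.sub_le_sub (EReal.coe_ennreal_le_coe_ennreal_iff.2 hab) le_rfl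
  have h := hcont.comp_lowerSemicontinuous
    (lowerSemicontinuous_lintegral_ofReal hlsc fun x ↦ by
      have := hfC x
      simp only [Pi.zero_apply]
      linarith) hmono
  convert h using 2 with P
  exact cost_eq_lintegral_sub hf.measurable (abs_nonneg m) hfC _

end LowerSemicontinuity

/-! ### Existence of a solution by compactness -/

section Existence

variable {X Y : Type*}

/-- The extension by zero to `Fin N × Z` of a function on the `i`-th copy of `Z`. -/
noncomputable def extendZero {Z : Type*} {N : ℕ} (i : Fin N) (f : Z → ℝ) (p : Fin N × Z) : ℝ :=
  if p.1 = i then f p.2 else 0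

/-- The copies of `Z` are open, so the jump to zero between them is harmless whatever the sign of
`f`. -/
theorem lowerSemicontinuous_extendZero {Z : Type*} [TopologicalSpace Z] {N : ℕ} (i : Fin N)
    {f : Z → ℝ} (hf : LowerSemicontinuous f) : LowerSemicontinuous (extendZero i f) := by
  rintro ⟨k, z⟩ y hy
  have hk : ∀ᶠ p : Fin N × Z in 𝓝 (k, z), p.1 = k :=
    continuous_fst.continuousAt.eventually (by simp : ∀ᶠ l in 𝓝 ((k, z) : Fin N × Z).1, l = k)
  by_cases h : k = i
  · have hz : ∀ᶠ p : Fin N × Z in 𝓝 (k, z), y < f p.2 :=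
      (continuous_snd.tendsto (k, z)).eventually (hf z y (by simpa [extendZero, h] using hy))
    filter_upwards [hk, hz] with p h1 h2
    simpa [extendZero, h1, h] using h2
  · filter_upwards [hk] with p h1
    simpa [extendZero, h1, h] using hy

theorem bddBelow_range_extendZero {Z : Type*} {N : ℕ} (i : Fin N) {f : Z → ℝ}
    (hf : BddBelow (Set.range f)) : BddBelow (Set.range (extendZero i f)) := by
  obtain ⟨m, hm⟩ := hf
  refine ⟨min m 0, ?_⟩
  rintro _ ⟨p, rfl⟩
  unfold extendZero
  split_ifs
  · exact (min_le_left _ _).trans (hm ⟨_, rfl⟩)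
  · exact min_le_right _ _

theorem lintegral_comp_extendZero {Z : Type*} [MeasurableSpace Z] {N : ℕ} (i : Fin N)
    {f : Z → ℝ} (hf : Measurable f) {φ : ℝ → ℝ≥0∞} (hφ : Measurable φ) (hφ0 : φ 0 = 0)
    (P : Measure (Fin N × Z)) :
    ∫⁻ p, φ (extendZero i f p) ∂P
      = ∫⁻ z, φ (f z) ∂((P.restrict (Prod.fst ⁻¹' {i})).map Prod.snd) := by
  rw [lintegral_map (by fun_prop) measurable_snd,
    ← lintegral_indicator (measurable_fst (measurableSet_singleton i))]
  refine lintegral_congr fun p ↦ ?_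
  by_cases h : p.1 = i <;> simp [extendZero, Set.indicator, h, hφ0]

/-- Makes the cost of one piece the integral of a fixed function against the whole measure, so that
weak convergence applies. -/
theorem cost_extendZero {Z : Type*} [MeasurableSpace Z] {N : ℕ} (i : Fin N)
    {f : Z → ℝ} (hf : Measurable f) (P : Measure (Fin N × Z)) :
    cost (extendZero i f) P
      = cost f ((P.restrict (Prod.fst ⁻¹' {i})).map Prod.snd) := by
  unfold cost
  rw [lintegral_comp_extendZero i hf ENNReal.measurable_ofReal (by simp),
    lintegral_comp_extendZero i hf (φ := fun x ↦ ENNReal.ofReal (-x)) (by fun_prop) (by simp)]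

theorem sum_map_snd_restrict {Z : Type*} [MeasurableSpace Z] {N : ℕ}
    (P : Measure (Fin N × Z)) :
    ∑ i, (P.restrict (Prod.fst ⁻¹' {i})).map Prod.snd = P.map Prod.snd := by
  rw [← Measure.map_finset_sum' measurable_snd.aemeasurable]
  congr 1
  rw [← Measure.sum_fintype, ← Measure.restrict_iUnion (fun i j hij ↦ ?_)
    (fun i ↦ measurable_fst (measurableSet_singleton i))]
  · convert Measure.restrict_univ
    ext p
    simp
  · refine Disjoint.preimage _ ?_
    simpa using hij

/-- The measure on `Fin N × Z` whose restriction to the `i`-th copy of `Z` is `γ i`. -/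
noncomputable def glue {Z : Type*} [MeasurableSpace Z] {N : ℕ} (γ : Fin N → Measure Z) :
    Measure (Fin N × Z) :=
  ∑ k, (γ k).map (Prod.mk k)

theorem map_snd_restrict_glue {Z : Type*} [MeasurableSpace Z] {N : ℕ} (γ : Fin N → Measure Z)
    (i : Fin N) : ((glue γ).restrict (Prod.fst ⁻¹' {i})).map Prod.snd = γ i := by
  ext s hs
  rw [Measure.map_apply measurable_snd hs, Measure.restrict_apply (measurable_snd hs), glue,
    Measure.finsetSum_apply, Finset.sum_eq_single i]
  · rw [Measure.map_apply measurable_prodMk_left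
      ((measurable_snd hs).inter (measurable_fst (measurableSet_singleton i)))]
    congr 1
    ext z
    simp
  · intro k _ hk
    rw [Measure.map_apply measurable_prodMk_left
      ((measurable_snd hs).inter (measurable_fst (measurableSet_singleton i)))]
    convert measure_empty (μ := γ k)
    ext z
    simp [hk]
  · simp

theorem couplingDecomps_nonempty [MeasurableSpace X] [MeasurableSpace Y] {N : ℕ} (hN : 1 ≤ N) (μ : Measure X) [IsProbabilityMeasure μ]
    (ν : Measure Y) [IsProbabilityMeasure ν] : (couplingDecomps N μ ν).Nonempty := by
  refine ⟨Pi.single ⟨0, hN⟩ (μ.prod ν), ?_⟩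
  constructor <;> simp

variable [TopologicalSpace X] [PolishSpace X] [MeasurableSpace X] [BorelSpace X]
  [TopologicalSpace Y] [PolishSpace Y] [MeasurableSpace Y] [BorelSpace Y]

/-- The probability measures on `Fin N × X × Y` with given marginals on `X` and `Y` form a compact
set. -/
theorem isCompact_setOf_marginals (N : ℕ) (μ : ProbabilityMeasure X) (ν : ProbabilityMeasure Y) :
    IsCompact {P : ProbabilityMeasure (Fin N × X × Y) |
      (P : Measure (Fin N × X × Y)).map (fun p ↦ p.2.1) = μ ∧
      (P : Measure (Fin N × X × Y)).map (fun p ↦ p.2.2) = ν} := by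
  let := TopologicalSpace.upgradeIsCompletelyMetrizable X
  let := TopologicalSpace.upgradeIsCompletelyMetrizable Y
  have hX : Continuous fun p : Fin N × X × Y ↦ p.2.1 := by fun_prop
  have hY : Continuous fun p : Fin N × X × Y ↦ p.2.2 := by fun_prop
  set S := {P : ProbabilityMeasure (Fin N × X × Y) |
      (P : Measure (Fin N × X × Y)).map (fun p ↦ p.2.1) = μ ∧
      (P : Measure (Fin N × X × Y)).map (fun p ↦ p.2.2) = ν}
  have hclosed : IsClosed S := by
    have h1 : IsClosed {P : ProbabilityMeasure (Fin N × X × Y) |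
        P.map hX.measurable.aemeasurable = μ} :=
      isClosed_eq (ProbabilityMeasure.continuous_map hX) continuous_const
    have h2 : IsClosed {P : ProbabilityMeasure (Fin N × X × Y) |
        P.map hY.measurable.aemeasurable = ν} :=
      isClosed_eq (ProbabilityMeasure.continuous_map hY) continuous_const
    convert h1.inter h2 using 1
    ext P
    exact and_congr (Subtype.ext_iff (a1 := P.map hX.measurable.aemeasurable) (a2 := μ)).symm
      (Subtype.ext_iff (a1 := P.map hY.measurable.aemeasurable) (a2 := ν)).symm
  rw [← hclosed.closure_eq]
  refine isCompact_closure_of_isTightMeasureSet ?_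
  refine IsTightMeasureSet.prodMk IsTightMeasureSet.of_compactSpace
    (IsTightMeasureSet.prodMk ?_ ?_)
  · refine (isTightMeasureSet_singleton (μ := (μ : Measure X))).subset ?_
    rintro _ ⟨_, ⟨_, ⟨P, hP, rfl⟩, rfl⟩, rfl⟩
    rw [Set.mem_singleton_iff, ← hP.1]
    exact Measure.map_map measurable_fst measurable_snd
  · refine (isTightMeasureSet_singleton (μ := (ν : Measure Y))).subset ?_
    rintro _ ⟨_, ⟨_, ⟨P, hP, rfl⟩, rfl⟩, rfl⟩
    rw [Set.mem_singleton_iff, ← hP.2]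
    exact Measure.map_map measurable_snd measurable_snd

/-- The equitable and optimal transport problem has a solution. -/
theorem exists_isSolution {N : ℕ} (hN : 1 ≤ N) {c : Fin N → X × Y → ℝ}
    (hc : ∀ i, LowerSemicontinuous (c i)) (hb : ∀ i, BddBelow (Set.range (c i)))
    (μ : Measure X) [IsProbabilityMeasure μ] (ν : Measure Y) [IsProbabilityMeasure ν] :
    ∃ γ, IsSolution c μ ν γ := by
  set S := {P : ProbabilityMeasure (Fin N × X × Y) |
      (P : Measure (Fin N × X × Y)).map (fun p ↦ p.2.1) = μ ∧
      (P : Measure (Fin N × X × Y)).map (fun p ↦ p.2.2) = ν}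
  have hS : IsCompact S := isCompact_setOf_marginals N ⟨μ, inferInstance⟩ ⟨ν, inferInstance⟩
  set split : ProbabilityMeasure (Fin N × X × Y) → Fin N → Measure (X × Y) := fun P i ↦
    ((P : Measure (Fin N × X × Y)).restrict (Prod.fst ⁻¹' {i})).map Prod.snd
  have hsplit : ∀ P ∈ S, split P ∈ couplingDecomps N μ ν := by
    intro P hP
    change (∑ i, split P i).map Prod.fst = μ ∧ (∑ i, split P i).map Prod.snd = ν
    rw [sum_map_snd_restrict, Measure.map_map measurable_fst measurable_snd,
      Measure.map_map measurable_snd measurable_snd]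
    exact hP
  have hsurj : ∀ γ ∈ couplingDecomps N μ ν, ∃ P ∈ S, split P = γ := by
    intro γ hγ
    have hsum : (glue γ).map Prod.snd = ∑ i, γ i := by
      rw [← sum_map_snd_restrict]
      simp_rw [map_snd_restrict_glue]
    have h1 : (glue γ).map (fun p ↦ p.2.1) = μ := by
      rw [← hγ.1, ← hsum, Measure.map_map measurable_fst measurable_snd]
      rfl
    have h2 : (glue γ).map (fun p ↦ p.2.2) = ν := by
      rw [← hγ.2, ← hsum, Measure.map_map measurable_snd measurable_snd]
      rfl
    have hP : IsProbabilityMeasure (glue γ) := by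
      refine ⟨?_⟩
      have := congrArg (fun m : Measure X ↦ m Set.univ) h1
      rwa [Measure.map_apply (by fun_prop) MeasurableSet.univ, measure_univ] at this
    exact ⟨⟨glue γ, hP⟩, ⟨h1, h2⟩, funext fun i ↦ map_snd_restrict_glue γ i⟩
  have hSne : S.Nonempty := by
    obtain ⟨γ, hγ⟩ := couplingDecomps_nonempty hN μ ν
    obtain ⟨P, hP, -⟩ := hsurj γ hγ
    exact ⟨P, hP⟩
  have hlsc : LowerSemicontinuous fun P ↦ maxCost c (split P) := by
    have : ∀ i, LowerSemicontinuous fun P : ProbabilityMeasure (Fin N × X × Y) ↦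
        cost (extendZero i (c i)) (P : Measure (Fin N × X × Y)) := fun i ↦
      lowerSemicontinuous_cost (lowerSemicontinuous_extendZero i (hc i))
        (bddBelow_range_extendZero i (hb i))
    refine lowerSemicontinuous_iSup fun i ↦ ?_
    convert this i using 2 with P
    exact (cost_extendZero i (hc i).measurable _).symm
  obtain ⟨P, hPS, hP⟩ := (hlsc.lowerSemicontinuousOn S).exists_isMinOn hSne hS
  refine ⟨split P, hsplit P hPS, le_antisymm (le_iInf₂ fun γ hγ ↦ ?_)
    (iInf₂_le _ (hsplit P hPS))⟩
  obtain ⟨Q, hQ, rfl⟩ := hsurj γ hγ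
  exact hP hQ

end Existence

/-! ### Exchange of mass between pieces -/

section Exchange

variable {Z : Type*} [MeasurableSpace Z] {N : ℕ}

/-- If all the pieces cost at most `M < ∞` and one of them costs less, moving mass onto that piece
makes all the pieces cost less than `M`. -/
theorem exists_forall_lintegral_lt {f : Fin N → Z → ℝ≥0∞} (hf : ∀ i, Measurable (f i))
    (hfin : ∀ i z, f i z ≠ ⊤) {γ : Fin N → Measure Z} (hγ : (∑ i, γ i) Set.univ ≠ ⊤)
    {M : ℝ≥0∞} (hM : M ≠ ⊤) (hle : ∀ i, ∫⁻ z, f i z ∂γ i ≤ M) {j : Fin N}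
    (hj : ∫⁻ z, f j z ∂γ j < M) :
    ∃ γ' : Fin N → Measure Z, ∑ i, γ' i = ∑ i, γ i ∧ ∀ i, ∫⁻ z, f i z ∂γ' i < M := by
  obtain ⟨n, hn0, hn⟩ := ENNReal.exists_nnreal_pos_mul_lt hγ (tsub_pos_of_lt hj).ne'
  set ε : ℝ≥0∞ := min (n : ℝ≥0∞) 1
  have hε0 : ε ≠ 0 := (lt_min (by exact_mod_cast hn0) one_pos).ne'
  have hε1 : ε ≤ 1 := min_le_right _ _
  have hεM : ∫⁻ z, f j z ∂γ j + ε * (∑ i, γ i) Set.univ < M :=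
    lt_tsub_iff_left.1 (lt_of_le_of_lt (mul_le_mul_left (min_le_left _ _) _) hn)
  set m := ∑ i, γ i
  -- The fraction of mass moved to piece `j`. The damping gives `w * f j ≤ ε` even for unbounded `f
  -- j`, so piece `j` gains at most `ε * m univ`; positivity of `w` makes the other pieces lose.
  set w : Z → ℝ≥0∞ := fun z ↦ ε * (1 + f j z)⁻¹ with hw
  have hwm : Measurable w := by fun_prop
  have hinv : ∀ z, (1 + f j z)⁻¹ ≤ 1 := fun z ↦ ENNReal.inv_le_one.2 le_self_add
  have hw1 : ∀ z, w z ≤ 1 := fun z ↦ mul_le_one' hε1 (hinv z)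
  have hw0 : ∀ z, w z ≠ 0 := fun z ↦
    mul_ne_zero hε0 (ENNReal.inv_ne_zero.2 (ENNReal.add_ne_top.2 ⟨one_ne_top, hfin j z⟩))
  have hwf : ∀ z, w z * f j z ≤ ε := fun z ↦ by
    rw [hw, mul_assoc]
    refine mul_le_of_le_one_right' ?_
    calc (1 + f j z)⁻¹ * f j z ≤ (1 + f j z)⁻¹ * (1 + f j z) := by gcongr; exact le_add_self
      _ ≤ 1 := ENNReal.inv_mul_le_one _
  have hw' : Measurable fun z ↦ 1 - w z := by fun_prop
  have hsplit : ∀ (i : Fin N) (α : Measure Z),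
      ∫⁻ z, (1 - w z) * f i z ∂α + ∫⁻ z, w z * f i z ∂α = ∫⁻ z, f i z ∂α := by
    intro i α
    rw [← lintegral_add_left (by fun_prop)]
    refine lintegral_congr fun z ↦ ?_
    rw [← add_mul, tsub_add_cancel_of_le (hw1 z), one_mul]
  refine ⟨fun i ↦ (γ i).withDensity (fun z ↦ 1 - w z) + if i = j then m.withDensity w else 0,
    ?_, fun i ↦ ?_⟩
  · rw [Finset.sum_add_distrib, Finset.sum_ite_eq' Finset.univ j, if_pos (Finset.mem_univ j)]
    ext s hs
    simp only [Measure.add_apply, Measure.finsetSum_apply, withDensity_apply _ hs, m]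
    rw [← Measure.sum_fintype, Measure.restrict_sum _ hs, lintegral_sum_measure, tsum_fintype, ← Finset.sum_add_distrib]
    refine Finset.sum_congr rfl fun i _ ↦ ?_
    rw [← lintegral_add_left hw', ← setLIntegral_one]
    refine lintegral_congr fun z ↦ ?_
    rw [tsub_add_cancel_of_le (hw1 z)]
  · rw [lintegral_add_measure, lintegral_withDensity_eq_lintegral_mul _ hw' (hf i)]
    by_cases hij : i = j
    · subst hij
      rw [if_pos rfl, lintegral_withDensity_eq_lintegral_mul _ hwm (hf i)]
      refine lt_of_le_of_lt (add_le_add ?_ ?_) hεM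
      · exact le_self_add.trans (hsplit i (γ i)).le
      · calc ∫⁻ z, (w * f i) z ∂m ≤ ∫⁻ _, ε ∂m := lintegral_mono hwf
          _ = ε * m Set.univ := lintegral_const _
    · rw [if_neg hij, lintegral_zero_measure, add_zero]
      -- Losing nothing from `M` would force `f i = 0` almost everywhere, hence `M = 0`, against
      -- `hj`.
      refine lt_of_le_of_ne (le_self_add.trans ((hsplit i (γ i)).le.trans (hle i))) fun heq ↦ ?_
      change ∫⁻ z, (1 - w z) * f i z ∂γ i = M at heq
      have h0 : ∫⁻ z, w z * f i z ∂γ i = 0 := by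
        have h := (hsplit i (γ i)).le.trans (hle i)
        rw [heq] at h
        by_contra hne
        exact (ENNReal.lt_add_right hM hne).not_ge h
      rw [lintegral_eq_zero_iff (by fun_prop)] at h0
      have h1 : ∫⁻ z, (1 - w z) * f i z ∂γ i = 0 := by
        rw [lintegral_eq_zero_iff (by fun_prop)]
        filter_upwards [h0] with z hz
        have : f i z = 0 := (mul_eq_zero.1 hz).resolve_left (hw0 z)
        simp [this]
      exact ENNReal.not_lt_zero (lt_of_lt_of_eq hj (heq.symm.trans h1))

/-- If all the pieces have utility at least `m` and one of them has more, sharing out a part of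
that piece makes all the utilities greater than `m`. -/
theorem exists_forall_lt_lintegral {g : Fin N → Z → ℝ≥0∞} (hg : ∀ i, Measurable (g i))
    (hpos : ∀ i z, 0 < g i z) {γ : Fin N → Measure Z} {m : ℝ≥0∞}
    (hle : ∀ i, m ≤ ∫⁻ z, g i z ∂γ i) {j : Fin N} (hj : m < ∫⁻ z, g j z ∂γ j)
    (hjfin : ∫⁻ z, g j z ∂γ j ≠ ⊤) :
    ∃ γ' : Fin N → Measure Z, ∑ i, γ' i = ∑ i, γ i ∧ ∀ i, m < ∫⁻ z, g i z ∂γ' i := by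
  obtain ⟨n, hn0, hn⟩ := ENNReal.exists_nnreal_pos_mul_lt hjfin (tsub_pos_of_lt hj).ne'
  set ε : ℝ≥0∞ := min (n : ℝ≥0∞) 1
  have hε0 : ε ≠ 0 := (lt_min (by exact_mod_cast hn0) one_pos).ne'
  have hε1 : ε ≤ 1 := min_le_right _ _
  have hN : (N : ℝ≥0∞) ≠ 0 := by
    have := j.pos
    exact_mod_cast this.ne'
  have hεj : m < (1 - ε) * ∫⁻ z, g j z ∂γ j := by
    rw [ENNReal.sub_mul fun _ _ ↦ hjfin, one_mul, lt_tsub_comm]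
    exact lt_of_le_of_lt (mul_le_mul_left (min_le_left _ _) _) hn
  have hγj : γ j ≠ 0 := by
    intro h
    simp [h] at hj
  have hsum : ∑ i, Function.update γ j ((1 - ε) • γ j) i + ε • γ j = ∑ i, γ i := by
    rw [Finset.sum_update_of_mem (Finset.mem_univ j), add_right_comm, ← add_smul,
      tsub_add_cancel_of_le hε1, one_smul, ← Finset.erase_eq,
      Finset.add_sum_erase _ _ (Finset.mem_univ j)]
  -- Piece `j` gives up the fraction `ε`, shared equally among all `N` pieces, itself included.
  refine ⟨fun i ↦ Function.update γ j ((1 - ε) • γ j) i + (ε / N) • γ j, ?_, fun i ↦ ?_⟩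
  · rw [Finset.sum_add_distrib, Finset.sum_const, Finset.card_univ, Fintype.card_fin, ← hsum,
      ← Nat.cast_smul_eq_nsmul ℝ≥0∞, smul_smul, ENNReal.mul_div_cancel hN (by simp)]
  · rw [lintegral_add_measure, lintegral_smul_measure]
    by_cases hij : i = j
    · subst hij
      rw [Function.update_self, lintegral_smul_measure]
      exact hεj.trans_le le_self_add
    · rw [Function.update_of_ne hij]
      -- Strict positivity of `g i` is essential: any nonzero share then has positive utility.
      have hne : (ε / N) • ∫⁻ z, g i z ∂γ j ≠ 0 := by
        refine mul_ne_zero (ENNReal.div_ne_zero.2 ⟨hε0, by simp⟩) ?_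
        rw [Ne, lintegral_eq_zero_iff (hg i)]
        intro h0
        refine hγj (ae_eq_bot.1 ?_)
        rw [← Filter.eventually_false_iff_eq_bot]
        filter_upwards [h0] with z hz using (hpos i z).ne' hz
      exact (ENNReal.lt_add_right hj.ne_top hne).trans_le (add_le_add (hle i) le_rfl)

theorem cost_of_nonneg {c : Z → ℝ} (hc : ∀ z, 0 ≤ c z) (γ : Measure Z) :
    cost c γ = ((∫⁻ z, ENNReal.ofReal (c z) ∂γ : ℝ≥0∞) : EReal) := by
  simp [cost, ENNReal.ofReal_of_nonpos (neg_nonpos.2 (hc _))]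

theorem cost_of_nonpos {c : Z → ℝ} (hc : ∀ z, c z ≤ 0) (γ : Measure Z) :
    cost c γ = -((∫⁻ z, ENNReal.ofReal (-c z) ∂γ : ℝ≥0∞) : EReal) := by
  simp [cost, ENNReal.ofReal_of_nonpos (hc _)]

end Exchange

/-! ### Equal costs, optimality of the pieces and common values of `W` -/

section Solutions

variable {X Y : Type*} [MeasurableSpace X] [MeasurableSpace Y] {N : ℕ}
  {c : Fin N → X × Y → ℝ} {μ : Measure X} {ν : Measure Y} {γ : Fin N → Measure (X × Y)}

theorem measure_univ_of_mem_couplingDecomps (hγ : γ ∈ couplingDecomps N μ ν) :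
    (∑ i, γ i) Set.univ = μ Set.univ := by
  rw [← hγ.1, Measure.map_apply measurable_fst MeasurableSet.univ, Set.preimage_univ]

theorem value_lt_of_forall_cost_lt [Nonempty (Fin N)] (hγ : γ ∈ couplingDecomps N μ ν)
    {M : EReal} (h : ∀ i, cost (c i) (γ i) < M) : value c μ ν < M := by
  refine lt_of_le_of_lt (iInf₂_le γ hγ) ?_
  obtain ⟨i, hi⟩ := exists_eq_ciSup_of_finite (f := fun i ↦ cost (c i) (γ i))
  exact lt_of_eq_of_lt hi.symm (h i)

theorem value_lt_maxCost_of_nonneg [IsFiniteMeasure μ] (hc : ∀ i, Measurable (c i))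
    (h0 : ∀ i z, 0 ≤ c i z) (hγ : γ ∈ couplingDecomps N μ ν) (hfin : maxCost c γ ≠ ⊤)
    {j : Fin N} (hj : cost (c j) (γ j) < maxCost c γ) : value c μ ν < maxCost c γ := by
  have : Nonempty (Fin N) := ⟨j⟩
  obtain ⟨k, hk⟩ := exists_eq_ciSup_of_finite (f := fun i ↦ cost (c i) (γ i))
  change _ = maxCost c γ at hk
  have hle : ∀ i, cost (c i) (γ i) ≤ maxCost c γ := le_iSup fun i ↦ cost (c i) (γ i)
  simp_rw [← hk, cost_of_nonneg (h0 _)] at hfin hj hle ⊢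
  obtain ⟨γ', hsum, hlt⟩ := exists_forall_lintegral_lt (f := fun i z ↦ ENNReal.ofReal (c i z))
    (fun i ↦ (hc i).ennreal_ofReal) (fun _ _ ↦ ofReal_ne_top)
    (by rw [measure_univ_of_mem_couplingDecomps hγ]; exact measure_ne_top μ _)
    (fun h ↦ hfin (by rw [h]; rfl)) (fun i ↦ EReal.coe_ennreal_le_coe_ennreal_iff.1 (hle i))
    (EReal.coe_ennreal_lt_coe_ennreal_iff.1 hj)
  refine value_lt_of_forall_cost_lt (γ := γ') ?_ fun i ↦ ?_
  · rw [couplingDecomps, Set.mem_ofPred_eq, hsum]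
    exact hγ
  · rw [cost_of_nonneg (h0 _)]
    exact EReal.coe_ennreal_lt_coe_ennreal_iff.2 (hlt i)

theorem value_lt_maxCost_of_neg [IsFiniteMeasure μ] (hc : ∀ i, Measurable (c i))
    (hb : ∀ i, BddBelow (Set.range (c i))) (h0 : ∀ i z, c i z < 0)
    (hγ : γ ∈ couplingDecomps N μ ν)
    {j : Fin N} (hj : cost (c j) (γ j) < maxCost c γ) : value c μ ν < maxCost c γ := by
  have : Nonempty (Fin N) := ⟨j⟩
  obtain ⟨k, hk⟩ := exists_eq_ciSup_of_finite (f := fun i ↦ cost (c i) (γ i))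
  change _ = maxCost c γ at hk
  have hle : ∀ i, cost (c i) (γ i) ≤ maxCost c γ := le_iSup fun i ↦ cost (c i) (γ i)
  simp_rw [← hk, cost_of_nonpos fun z ↦ (h0 _ z).le, EReal.neg_lt_neg_iff,
    EReal.neg_le_neg_iff] at hj hle ⊢
  obtain ⟨C, hC⟩ := hb j
  have hjfin : ∫⁻ z, ENNReal.ofReal (-c j z) ∂γ j ≠ ⊤ := by
    have hmass : γ j Set.univ ≠ ⊤ := by
      refine ne_top_of_le_ne_top (measure_ne_top μ Set.univ) ?_
      rw [← measure_univ_of_mem_couplingDecomps hγ, Measure.finsetSum_apply]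
      exact Finset.single_le_sum (f := fun i ↦ γ i Set.univ) (fun _ _ ↦ zero_le) (Finset.mem_univ j)
    refine ne_top_of_le_ne_top (ENNReal.mul_ne_top (ofReal_ne_top (r := -C)) hmass) ?_
    calc ∫⁻ z, ENNReal.ofReal (-c j z) ∂γ j ≤ ∫⁻ _, ENNReal.ofReal (-C) ∂γ j :=
          lintegral_mono fun z ↦ ENNReal.ofReal_le_ofReal (neg_le_neg (hC ⟨z, rfl⟩))
      _ = _ := lintegral_const _
  obtain ⟨γ', hsum, hlt⟩ := exists_forall_lt_lintegral (g := fun i z ↦ ENNReal.ofReal (-c i z))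
    (fun i ↦ (hc i).neg.ennreal_ofReal) (fun i z ↦ ENNReal.ofReal_pos.2 (neg_pos.2 (h0 i z)))
    (fun i ↦ EReal.coe_ennreal_le_coe_ennreal_iff.1 (hle i))
    (EReal.coe_ennreal_lt_coe_ennreal_iff.1 hj) hjfin
  refine value_lt_of_forall_cost_lt (γ := γ') ?_ fun i ↦ ?_
  · rw [couplingDecomps, Set.mem_ofPred_eq, hsum]
    exact hγ
  · rw [cost_of_nonpos fun z ↦ (h0 _ z).le, EReal.neg_lt_neg_iff]
    exact EReal.coe_ennreal_lt_coe_ennreal_iff.2 (hlt i)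

/-- If no tuple with unequal costs is optimal, the costs of a solution of finite value are equal. -/
theorem IsSolution.cost_eq_value
    (hexch : ∀ γ ∈ couplingDecomps N μ ν, maxCost c γ ≠ ⊤ → ∀ j,
      cost (c j) (γ j) < maxCost c γ → value c μ ν < maxCost c γ)
    (hγ : IsSolution c μ ν γ) (hfin : value c μ ν ≠ ⊤) (i : Fin N) :
    cost (c i) (γ i) = value c μ ν := by
  by_contra hne
  have hlt : cost (c i) (γ i) < maxCost c γ :=
    lt_of_le_of_ne (le_iSup (fun i ↦ cost (c i) (γ i)) i) (by rwa [hγ.2])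
  exact (hexch γ hγ.1 (by rwa [hγ.2]) i hlt).ne hγ.2.symm

theorem map_sum_update {S T : Type*} [MeasurableSpace S] [MeasurableSpace T] {φ : S → T}
    (hφ : Measurable φ) {γ : Fin N → Measure S} {i : Fin N} {γ' : Measure S}
    (h : γ'.map φ = (γ i).map φ) :
    (∑ k, Function.update γ i γ' k).map φ = (∑ k, γ k).map φ := by
  rw [Measure.map_finset_sum' hφ.aemeasurable, Measure.map_finset_sum' hφ.aemeasurable]
  refine Finset.sum_congr rfl fun k _ ↦ ?_
  rcases eq_or_ne k i with rfl | hk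
  · simpa using h
  · simp [hk]

/-- If no tuple with unequal costs is optimal, the components of a solution of finite value are
optimal transport plans. -/
theorem IsSolution.isOptimalPlan
    (hexch : ∀ γ ∈ couplingDecomps N μ ν, maxCost c γ ≠ ⊤ → ∀ j,
      cost (c j) (γ j) < maxCost c γ → value c μ ν < maxCost c γ)
    (hγ : IsSolution c μ ν γ) (hfin : value c μ ν ≠ ⊤) (i : Fin N) :
    IsOptimalPlan (c i) ((γ i).map Prod.fst) ((γ i).map Prod.snd) (γ i) := by
  refine ⟨⟨rfl, rfl⟩, fun γ' hγ' ↦ ?_⟩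
  by_contra! hlt
  rw [hγ.cost_eq_value hexch hfin i] at hlt
  set η := Function.update γ i γ'
  have hη : η ∈ couplingDecomps N μ ν :=
    ⟨(map_sum_update measurable_fst hγ'.1).trans hγ.1.1, (map_sum_update measurable_snd hγ'.2).trans hγ.1.2⟩
  have hηi : cost (c i) (η i) < value c μ ν := by simpa [η] using hlt
  -- No entry exceeds the value and `η` is admissible, so `η` is optimal too, yet its entry `i` is
  -- strictly below the maximum.
  have hmax : maxCost c η = value c μ ν := by
    refine le_antisymm (iSup_le fun k ↦ ?_) (iInf₂_le η hη)
    rcases eq_or_ne k i with rfl | hk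
    · exact hηi.le
    · rw [← hγ.cost_eq_value hexch hfin k]
      simp [η, hk]
  exact (hexch η hη (by rwa [hmax]) i (by rwa [hmax])).ne hmax.symm

/-- Near-optimal plans for each `s > t` suffice, so attainment of `W` is not needed. -/
theorem value_le_of_W_eq [Nonempty (Fin N)] {p : Fin N → Measure X × Measure Y}
    (hp : p ∈ marginalDecomps N μ ν) {t : EReal} (ht : ∀ i, W (c i) (p i).1 (p i).2 = t) :
    value c μ ν ≤ t := by
  refine le_of_forall_gt fun s hs ↦ ?_
  have hex : ∀ i, ∃ η ∈ couplings (p i).1 (p i).2, cost (c i) η < s := by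
    intro i
    have := hs
    rw [← ht i, W, iInf_lt_iff] at this
    obtain ⟨η, hη⟩ := this
    rw [iInf_lt_iff] at hη
    exact ⟨η, hη.1, hη.2⟩
  choose η hη hcost using hex
  refine value_lt_of_forall_cost_lt (γ := η) ⟨?_, ?_⟩ hcost
  · rw [Measure.map_finset_sum' measurable_fst.aemeasurable, ← hp.1]
    exact Finset.sum_congr rfl fun i _ ↦ (hη i).1
  · rw [Measure.map_finset_sum' measurable_snd.aemeasurable, ← hp.2.1]
    exact Finset.sum_congr rfl fun i _ ↦ (hη i).2

theorem marginals_mem_marginalDecomps (hγ : γ ∈ couplingDecomps N μ ν) :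
    (fun i ↦ ((γ i).map Prod.fst, (γ i).map Prod.snd)) ∈ marginalDecomps N μ ν := by
  refine ⟨?_, ?_, fun i ↦ ?_⟩
  · rw [← hγ.1, Measure.map_finset_sum' measurable_fst.aemeasurable]
  · rw [← hγ.2, Measure.map_finset_sum' measurable_snd.aemeasurable]
  · simp [Measure.map_apply measurable_fst, Measure.map_apply measurable_snd]

theorem IsOptimalPlan.W_eq {c : X × Y → ℝ} {γ : Measure (X × Y)} (h : IsOptimalPlan c μ ν γ) :
    W c μ ν = cost c γ :=
  le_antisymm (iInf₂_le γ h.1) (le_iInf₂ h.2)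

/-- When the value is infinite, every plan of each cost between proportional parts of `μ` and `ν`
is infinitely expensive. -/
theorem W_smul_eq_top_of_value_eq_top (h0 : ∀ i z, 0 ≤ c i z) (htop : value c μ ν = ⊤)
    {a : ℝ≥0∞} (ha0 : a ≠ 0) (ha : a ≠ ⊤) (i : Fin N) : W (c i) (a • μ) (a • ν) = ⊤ := by
  refine iInf₂_eq_top.2 fun γ hγ ↦ ?_
  -- All the mass sits on piece `i`, the only one that can then cost `∞`.
  set η : Fin N → Measure (X × Y) := Pi.single i (a⁻¹ • γ)
  have hη : η ∈ couplingDecomps N μ ν := by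
    rw [couplingDecomps, Set.mem_ofPred_eq, Finset.sum_pi_single' i]
    simp [Measure.map_smul, hγ.1, hγ.2, smul_smul, ENNReal.inv_mul_cancel ha0 ha]
  have hmax : maxCost c η = ⊤ := top_le_iff.1 (htop ▸ iInf₂_le η hη)
  have : Nonempty (Fin N) := ⟨i⟩
  obtain ⟨k, hk⟩ := exists_eq_ciSup_of_finite (f := fun i ↦ cost (c i) (η i))
  change _ = maxCost c η at hk
  rw [hmax, cost_of_nonneg (h0 k), EReal.coe_ennreal_eq_top_iff] at hk
  rw [cost_of_nonneg (h0 i), EReal.coe_ennreal_eq_top_iff]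
  rcases eq_or_ne k i with rfl | hki
  · simp only [η, Pi.single_eq_same, lintegral_smul_measure, smul_eq_mul] at hk
    by_contra hne
    exact ENNReal.mul_ne_top (ENNReal.inv_ne_top.2 ha0) hne hk
  · simp [η, hki] at hk

end Solutions

end EOT

theorem proposition2 {X Y : Type*}
    [TopologicalSpace X] [PolishSpace X] [MeasurableSpace X] [BorelSpace X]
    [TopologicalSpace Y] [PolishSpace Y] [MeasurableSpace Y] [BorelSpace Y]
    (N : ℕ) (hN : 1 ≤ N) (c : Fin N → X × Y → ℝ) (hc : EOT.ConstantSign c)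
    (μ : Measure X) [IsProbabilityMeasure μ] (ν : Measure Y) [IsProbabilityMeasure ν] :
    (EOT.value c μ ν ≠ ⊤ →
      ∀ γ : Fin N → Measure (X × Y), EOT.IsSolution c μ ν γ →
        ∀ i, EOT.IsOptimalPlan (c i) ((γ i).map Prod.fst) ((γ i).map Prod.snd) (γ i)) ∧
    IsLeast {t : EReal | ∃ p ∈ EOT.marginalDecomps N μ ν,
        ∀ i, EOT.W (c i) (p i).1 (p i).2 = t}
      (EOT.value c μ ν) := by
  have : Nonempty (Fin N) := ⟨⟨0, hN⟩⟩
  have hexch : ∀ γ ∈ EOT.couplingDecomps N μ ν, EOT.maxCost c γ ≠ ⊤ → ∀ j,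
      EOT.cost (c j) (γ j) < EOT.maxCost c γ → EOT.value c μ ν < EOT.maxCost c γ := by
    intro γ hγ hfin j hj
    rcases hc with hc | hc
    · exact EOT.value_lt_maxCost_of_nonneg (fun i ↦ (hc i).1.measurable) (fun i ↦ (hc i).2) hγ
        hfin hj
    · exact EOT.value_lt_maxCost_of_neg (fun i ↦ (hc i).1.measurable) (fun i ↦ (hc i).2.1)
        (fun i ↦ (hc i).2.2) hγ hj
  refine ⟨fun hfin γ hγ i ↦ hγ.isOptimalPlan hexch hfin i, ?_,
    fun t ⟨p, hp, ht⟩ ↦ EOT.value_le_of_W_eq hp ht⟩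
  obtain ⟨γ, hγ⟩ : ∃ γ, EOT.IsSolution c μ ν γ := by
    refine EOT.exists_isSolution hN (fun i ↦ ?_) (fun i ↦ ?_) μ ν
    · rcases hc with hc | hc
      exacts [(hc i).1, (hc i).1]
    · rcases hc with hc | hc
      · exact ⟨0, by rintro _ ⟨z, rfl⟩; exact (hc i).2 z⟩
      · exact (hc i).2.1
  by_cases hfin : EOT.value c μ ν = ⊤
  · have h0 : ∀ i z, 0 ≤ c i z := by
      rcases hc with hc | hc
      · exact fun i ↦ (hc i).2
      -- Negative costs have non-positive integrals, so the value cannot be infinite.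
      · exfalso
        obtain ⟨k, hk⟩ := exists_eq_ciSup_of_finite (f := fun i ↦ EOT.cost (c i) (γ i))
        rw [← hγ.2, EOT.maxCost, ← hk, EOT.cost_of_nonpos fun z ↦ ((hc k).2.2 z).le,
          EReal.neg_eq_top_iff] at hfin
        exact EReal.coe_ennreal_ne_bot _ hfin
    have hN0 : (N : ENNReal) ≠ 0 := by exact_mod_cast (Nat.one_le_iff_ne_zero.1 hN)
    refine ⟨fun _ ↦ ((N : ENNReal)⁻¹ • μ, (N : ENNReal)⁻¹ • ν), ⟨?_, ?_, by simp⟩, fun i ↦ ?_⟩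
    · simp [← Nat.cast_smul_eq_nsmul ENNReal, smul_smul,
        ENNReal.mul_inv_cancel hN0 (ENNReal.natCast_ne_top N)]
    · simp [← Nat.cast_smul_eq_nsmul ENNReal, smul_smul,
        ENNReal.mul_inv_cancel hN0 (ENNReal.natCast_ne_top N)]
    · rw [hfin]
      exact EOT.W_smul_eq_top_of_value_eq_top h0 hfin (by simp) (by simpa using hN0) i
  · exact ⟨_, EOT.marginals_mem_marginalDecomps hγ.1, fun i ↦
      (hγ.isOptimalPlan hexch hfin i).W_eq.trans (hγ.cost_eq_value hexch hfin i)⟩
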